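/- For a graph $G$ and an integer $i\ge 1$, an $i$-packing in $G$ is a set of vertices in which any two distinct vertices are at distance greater than $i$. The packing chromatic number $\chi_\rho(G)$ is the smallest integer $k$ such that there is a map $c:V(G)\to\{1,\dots,k\}$ for which $c^{-1}(i)$ is an $i$-packing for each $i\in\{1,\dots,k\}$. For a graph $G$ on the vertex set $\{0,1,\dots,m-1\}$ and $n\ge 1$, the generalized Sierpiński graph $S^n_G$ has vertex set $\{0,1,\dots,m-1\}^n$, and $u=u_1\dots u_n$, $v=v_1\dots v_n$ are adjacent if and only if there is $i\in\{1,\dots,n\}$ such that $u_j=v_j$ for all $j<i$, $\{u_i,v_i\}\in E(G)$, and $u_j=v_i$, $v_j=u_i$ for all $j>i$. Let $K_4-e$ be the complete graph on $\{0,1,2,3\}$ with the edge $e=\{0,2\}$ removed. **Theorem.** $$\chi_\rho(S^1_{K_4-e})=3,\qquad \chi_\rho(S^2_{K_4-e})=6,\qquad \chi_\rho(S^3_{K_4-e})=8,$$ and for every $n\ge 4$, $$8\le \chi_\rho(S^n_{K_4-e})\le 11.$$ -/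

import Mathlib

namespace SimpleGraph

/-- An `i`-packing in `G`: a set of vertices in which any two distinct vertices are at distance
greater than `i`. Vertices in different components are at distance `⊤`. -/
def IsPacking {V : Type*} (G : SimpleGraph V) (i : ℕ) (W : Set V) : Prop :=
  ∀ u ∈ W, ∀ v ∈ W, u ≠ v → (i : ℕ∞) < G.edist u v

/-- A `k`-packing coloring of `G`: a map to the colors `1, …, k` in which the vertices of color `i`
form an `i`-packing. -/
def IsPackingColoring {V : Type*} (G : SimpleGraph V) (k : ℕ) (c : V → ℕ) : Prop :=
  (∀ v, 1 ≤ c v ∧ c v ≤ k) ∧ ∀ i, 1 ≤ i → i ≤ k → G.IsPacking i {v | c v = i}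

/-- The packing chromatic number `χ_ρ(G)`, the least `k` such that `G` has a `k`-packing coloring
(and `⊤` if there is no such `k`, which never happens for a finite graph). -/
noncomputable def packingChromaticNumber {V : Type*} (G : SimpleGraph V) : ℕ∞ :=
  ⨅ k ∈ {k : ℕ | ∃ c : V → ℕ, G.IsPackingColoring k c}, (k : ℕ∞)

/-- The generalized Sierpiński graph `S^n_G` of dimension `n` with base graph `G`. Its vertices are
the words of length `n` over the vertices of `G`; two words are adjacent when they have the form
`w x y y … y` and `w y x x … x` for an edge `{x, y}` of `G`. -/
def sierpinski {V : Type*} (G : SimpleGraph V) (n : ℕ) : SimpleGraph (Fin n → V) where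
  Adj u v := ∃ i : Fin n, (∀ j, j < i → u j = v j) ∧ G.Adj (u i) (v i) ∧
    ∀ j, i < j → u j = v i ∧ v j = u i
  symm := ⟨by
    rintro u v ⟨i, h₁, h₂, h₃⟩
    exact ⟨i, fun j hj => (h₁ j hj).symm, h₂.symm, fun j hj => (h₃ j hj).symm⟩⟩
  loopless := ⟨by
    rintro u ⟨i, -, h₂, -⟩
    exact h₂.ne rfl⟩

end SimpleGraph

/-- The graph `K₄ - e` on the vertex set `{0, 1, 2, 3}`, with removed edge `e = {0, 2}`. -/
def K4MinusEdge : SimpleGraph (Fin 4) :=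
  (⊤ : SimpleGraph (Fin 4)).deleteEdges {s(0, 2)}

/-! The upper bounds come from explicit colorings. For `n ≥ 4`, one coloring of `S^4` with 11 colors
is repeated on every block, that is, on every copy of `S^4` inside `S^n`. Distinct corners of `S^4`
are at distance at least 11, and a corner lies on at most one edge leaving its block. So a walk of
length at most 11 can be replaced by one, no longer, that crosses at most one edge between blocks
(`block_of_walk`). Conflicts therefore arise only inside a block or across a single such edge, and
both kinds are finite checks on `S^4` (`IsPackingColoring.suffix`).

For the lower bounds, `S^1` contains a triangle, and an exhaustive search excludes five colors on
`S^2`. On `S^3`, suppose seven colors suffice. Two vertices of the same copy of `S^2` are within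
distance 6, so each of the colors 6 and 7 occurs at most once in each of the four copies. Their
positions in a copy must lie in `options`, since otherwise the rest of the copy has no coloring with
`1, …, 5`. Any choice for the copies 1 and 3 then fails: the two choices conflict, or they leave no
option for copy 0 or for copy 2, or the rest of the copies 1 and 3 has no coloring with `1, …, 5`
(`pairs_complete`). For `n ≥ 4` the bound is inherited from `S^3`, which embeds in `S^n`.

In the finite checks words are base-4 numbers, sets of vertices are the bits of a natural number,
and balls are grown by shifting bits. The upper bounds need computed balls that contain the true
ones (`Covers`); the lower bounds need computed balls contained in them (`Follows`). -/

namespace SimpleGraph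

/-! ### Monotonicity of packing colorings -/

section Packing

variable {V W : Type*} {G : SimpleGraph V} {H : SimpleGraph W}

theorem IsPackingColoring.mono {k l : ℕ} {c : V → ℕ} (hc : G.IsPackingColoring k c) (hkl : k ≤ l) :
    G.IsPackingColoring l c := by
  refine ⟨fun v => ⟨(hc.1 v).1, (hc.1 v).2.trans hkl⟩, fun i hi _ => ?_⟩
  by_cases hik : i ≤ k
  · exact hc.2 i hi hik
  · intro u hu
    exact absurd ((hc.1 u).2.trans' (le_of_eq hu.symm)) hik

theorem edist_map_le (φ : G →g H) (u v : V) : H.edist (φ u) (φ v) ≤ G.edist u v := by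
  refine le_iInf fun w => ?_
  rw [← w.length_map φ]
  exact (w.map φ).edist_le

/-- Homomorphisms do not increase distances, and injectivity keeps distinct vertices distinct. Hence
a lower bound for a graph passes to every graph into which it maps injectively. -/
theorem IsPackingColoring.comp {k : ℕ} {c : W → ℕ} (hc : H.IsPackingColoring k c) (φ : G →g H)
    (hφ : Function.Injective φ) : G.IsPackingColoring k (c ∘ φ) :=
  ⟨fun v => hc.1 (φ v), fun i hi hik u hu v hv huv =>
    (hc.2 i hi hik (φ u) hu (φ v) hv (hφ.ne huv)).trans_le (edist_map_le φ u v)⟩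

theorem packingChromaticNumber_le {k : ℕ} {c : V → ℕ} (hc : G.IsPackingColoring k c) :
    G.packingChromaticNumber ≤ k :=
  iInf₂_le k ⟨c, hc⟩

theorem le_packingChromaticNumber {k : ℕ} (h : ∀ c, ¬ G.IsPackingColoring k c) :
    (k + 1 : ℕ) ≤ G.packingChromaticNumber := by
  refine le_iInf₂ fun l ⟨c, hc⟩ => ?_
  by_contra hl
  exact h c (hc.mono (by exact_mod_cast Nat.lt_succ_iff.mp (by exact_mod_cast not_le.mp hl)))

end Packing

/-! ### Blocks of a Sierpiński graph and walks between them -/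

section Sierpinski

variable {V : Type*} {G : SimpleGraph V}

/-- The words `p` and `q` are joined by an edge of the Sierpiński graph that swaps letters from
the position `a` on. -/
def EdgeAt (G : SimpleGraph V) {n : ℕ} (p q : Fin n → V) (a : Fin n) : Prop :=
  (∀ j, j < a → p j = q j) ∧ G.Adj (p a) (q a) ∧ ∀ j, a < j → p j = q a ∧ q j = p a

theorem EdgeAt.symm {n : ℕ} {p q : Fin n → V} {a : Fin n} (h : G.EdgeAt p q a) :
    G.EdgeAt q p a :=
  ⟨fun j hj => (h.1 j hj).symm, h.2.1.symm, fun j hj => (h.2.2 j hj).symm⟩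

theorem EdgeAt.not_index_lt {n : ℕ} {p q q' : Fin n → V} {a b : Fin n} (h : G.EdgeAt p q a)
    (h' : G.EdgeAt p q' b) (hab : q a = q' b) : ¬ a < b := fun hlt =>
  h'.2.1.ne ((h.2.2 b hlt).1.trans hab)

/-- At most one edge leaves a block from a given corner: if two positions `a < b` gave the same
corner letter, then `p b` would equal that letter and be adjacent to itself. -/
theorem EdgeAt.unique {n : ℕ} {p q q' : Fin n → V} {a b : Fin n} (h : G.EdgeAt p q a)
    (h' : G.EdgeAt p q' b) (hab : q a = q' b) : a = b ∧ q = q' := by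
  obtain rfl : a = b := le_antisymm (not_lt.mp (h'.not_index_lt h hab.symm)) (not_lt.mp (h.not_index_lt h' hab))
  refine ⟨rfl, funext fun j => ?_⟩
  rcases lt_trichotomy j a with hj | rfl | hj
  · rw [← h.1 j hj, h'.1 j hj]
  · exact hab
  · rw [(h.2.2 j hj).2, (h'.2.2 j hj).2]

/-- The first `m` letters of a word of length `m + n`. -/
def pre (m n : ℕ) (u : Fin (m + n) → V) : Fin m → V := fun j => u (Fin.castAdd n j)

/-- The last `n` letters of a word of length `m + n`. -/
def suf (m n : ℕ) (u : Fin (m + n) → V) : Fin n → V := fun j => u (Fin.natAdd m j)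

theorem pre_suf_ext {m n : ℕ} {u v : Fin (m + n) → V} (h : pre m n u = pre m n v)
    (h' : suf m n u = suf m n v) : u = v :=
  funext fun j => Fin.addCases (fun i => congrFun h i) (fun i => congrFun h' i) j

theorem sierpinski_adj_add {m n : ℕ} {u v : Fin (m + n) → V}
    (h : (G.sierpinski (m + n)).Adj u v) :
    (pre m n u = pre m n v ∧ (G.sierpinski n).Adj (suf m n u) (suf m n v)) ∨
      ∃ a, G.EdgeAt (pre m n u) (pre m n v) a ∧ suf m n u = (fun _ => pre m n v a) ∧
        suf m n v = fun _ => pre m n u a := by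
  obtain ⟨i, h₁, h₂, h₃⟩ := h
  induction i using Fin.addCases with
  | left a =>
    have hlt : ∀ j : Fin n, Fin.castAdd n a < Fin.natAdd m j := fun j => by
      rw [Fin.lt_def]; simp; omega
    exact .inr ⟨a, ⟨fun j hj => h₁ _ hj, h₂, fun j hj => h₃ _ hj⟩,
      funext fun j => (h₃ _ (hlt j)).1, funext fun j => (h₃ _ (hlt j)).2⟩
  | right a =>
    refine .inl ⟨funext fun j => h₁ _ ?_, a, fun j hj => h₁ _ ?_, h₂, fun j hj => h₃ _ ?_⟩
    · rw [Fin.lt_def]; simp; omega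
    · rw [Fin.lt_def] at hj ⊢; simpa using hj
    · rw [Fin.lt_def] at hj ⊢; simpa using hj

/-- Prepending a fixed word embeds `S^n_G` into `S^(m+n)_G`. -/
def prependHom {m : ℕ} (w : Fin m → V) (n : ℕ) : G.sierpinski n →g G.sierpinski (m + n) where
  toFun u := Fin.append w u
  map_rel' := by
    rintro u v ⟨i, h₁, h₂, h₃⟩
    refine ⟨Fin.natAdd m i, fun j => ?_, by simpa using h₂, fun j => ?_⟩ <;>
      induction j using Fin.addCases with
      | left a => intro hj; rw [Fin.lt_def] at hj; simp at hj ⊢ <;> omega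
      | right a =>
        intro hj
        have hj' := hj
        rw [Fin.lt_def] at hj'
        simp only [Fin.val_natAdd, add_lt_add_iff_left] at hj'
        first
          | simpa using h₁ a hj'
          | simpa using h₃ a hj'

theorem prependHom_injective {m : ℕ} (w : Fin m → V) (n : ℕ) :
    Function.Injective (prependHom (G := G) w n) := fun u v h => funext fun j => by
  simpa [prependHom] using congrFun h (Fin.natAdd m j)

/-- A walk that meets a third block must traverse the middle one between two different corners,
which already costs `k` steps besides the connecting edges. What remains is a walk inside one block
or across a single edge. -/
theorem block_of_walk {m n k : ℕ}
    (hfar : ∀ i j : V, i ≠ j → (k : ℕ∞) ≤ (G.sierpinski n).edist (fun _ => i) (fun _ => j))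
    {u y : Fin (m + n) → V} (w : (G.sierpinski (m + n)).Walk u y) (hw : w.length ≤ k) :
    (pre m n u = pre m n y ∧ (G.sierpinski n).edist (suf m n u) (suf m n y) ≤ w.length) ∨
      ∃ a, G.EdgeAt (pre m n u) (pre m n y) a ∧
        (G.sierpinski n).edist (suf m n u) (fun _ => pre m n y a) + 1 +
          (G.sierpinski n).edist (fun _ => pre m n u a) (suf m n y) ≤ w.length := by
  induction w with
  | nil => exact .inl ⟨rfl, by simp⟩
  | @cons u u' y h w ih =>
    have hlen : ((Walk.cons h w).length : ℕ∞) = w.length + 1 := by simp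
    rw [hlen]
    have hk : w.length + 1 ≤ k := by simpa using hw
    rcases sierpinski_adj_add h with ⟨hp, hs⟩ | ⟨b, hb, hsu, hsu'⟩ <;>
      rcases ih (by omega) with ⟨hq, hd⟩ | ⟨a, ha, hd⟩
    · refine .inl ⟨hp.trans hq, (SimpleGraph.edist_triangle (v := suf m n u')).trans ?_⟩
      rw [edist_eq_one_iff_adj.mpr hs, add_comm]
      gcongr
    · refine .inr ⟨a, hp ▸ ha, ?_⟩
      rw [hp]
      calc _ ≤ (1 + (G.sierpinski n).edist (suf m n u') (fun _ => pre m n y a)) + 1 +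
            (G.sierpinski n).edist (fun _ => pre m n u' a) (suf m n y) := by
            gcongr
            refine (SimpleGraph.edist_triangle (v := suf m n u')).trans ?_
            rw [edist_eq_one_iff_adj.mpr hs]
        _ = ((G.sierpinski n).edist (suf m n u') (fun _ => pre m n y a) + 1 +
            (G.sierpinski n).edist (fun _ => pre m n u' a) (suf m n y)) + 1 := by ring
        _ ≤ _ := by gcongr
    · refine .inr ⟨b, hq ▸ hb, ?_⟩
      rw [← hq, hsu, edist_self, zero_add, add_comm, ← hsu']
      gcongr
    -- The walk enters the block of `u'` at one corner and leaves it at another. If the corners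
    -- agree, it returns through the same edge, so `y` is in the block of `u`. If not, the rest of
    -- the walk has length at least `k`, and the first edge exceeds the bound.
    · by_cases hab : pre m n u b = pre m n y a
      · obtain ⟨rfl, hp⟩ := hb.symm.unique ha hab
        refine .inl ⟨hp, ?_⟩
        rw [hsu]
        exact le_trans (le_add_left le_rfl) (hd.trans (by simp))
      · have h1 := hfar _ _ hab
        rw [← hsu'] at h1
        have h2 : (k : ℕ∞) ≤ w.length :=
          h1.trans (le_trans (by rw [add_assoc]; exact le_add_right le_rfl) hd)
        have h3 : k ≤ w.length := by exact_mod_cast h2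
        omega

/-- A packing coloring of `S^n_G` that is compatible with itself across the edges between blocks
colors all the larger graphs `S^(m+n)_G`. -/
theorem IsPackingColoring.suffix {n k : ℕ} {c : (Fin n → V) → ℕ}
    (hc : (G.sierpinski n).IsPackingColoring k c)
    (hfar : ∀ i j : V, i ≠ j → (k : ℕ∞) ≤ (G.sierpinski n).edist (fun _ => i) (fun _ => j))
    (hcross : ∀ i j : V, G.Adj i j → ∀ u v, c u = c v →
      (c u : ℕ∞) < (G.sierpinski n).edist u (fun _ => i) + 1 +
        (G.sierpinski n).edist (fun _ => j) v) (m : ℕ) :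
    (G.sierpinski (m + n)).IsPackingColoring k (fun u => c (suf m n u)) := by
  refine ⟨fun v => hc.1 _, fun i hi hik u hu v hv huv => ?_⟩
  by_contra hlt
  rw [not_lt] at hlt
  have hne : (G.sierpinski (m + n)).edist u v ≠ ⊤ := ne_top_of_le_ne_top (by simp) hlt
  obtain ⟨w, hw⟩ := exists_walk_of_edist_ne_top hne
  have hwi : w.length ≤ i := by rw [← hw] at hlt; exact_mod_cast hlt
  have hwi' : (w.length : ℕ∞) ≤ i := by exact_mod_cast hwi
  simp only [Set.mem_ofPred_eq] at hu hv
  rcases block_of_walk hfar w (hwi.trans hik) with ⟨hp, hd⟩ | ⟨a, ha, hd⟩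
  · exact absurd (hd.trans hwi')
      (not_le.mpr (hc.2 i hi hik _ hu _ hv fun h => huv (pre_suf_ext hp h)))
  -- The vertex `u` leaves its block through the corner named by the letter of `v`, so the adjacent
  -- letters appear in reverse order.
  · have := hcross _ _ ha.2.1.symm (suf m n u) (suf m n v) (hu.trans hv.symm)
    rw [hu] at this
    exact absurd (hd.trans hwi') (not_le.mpr this)

theorem sierpinski_adj_succ {n : ℕ} {u v : Fin (n + 1) → V} :
    (G.sierpinski (n + 1)).Adj u v ↔
      (u 0 = v 0 ∧ (G.sierpinski n).Adj (Fin.tail u) (Fin.tail v)) ∨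
        (G.Adj (u 0) (v 0) ∧ (Fin.tail u = fun _ => v 0) ∧ Fin.tail v = fun _ => u 0) := by
  constructor
  · rintro ⟨i, h₁, h₂, h₃⟩
    induction i using Fin.cases with
    | zero => exact .inr ⟨h₂, funext fun j => (h₃ _ j.succ_pos).1, funext fun j =>
        (h₃ _ j.succ_pos).2⟩
    | succ a => exact .inl ⟨h₁ 0 a.succ_pos, a, fun j hj => h₁ _ (Fin.succ_lt_succ_iff.mpr hj), h₂,
        fun j hj => h₃ _ (Fin.succ_lt_succ_iff.mpr hj)⟩
  · rintro (⟨h₀, a, h₁, h₂, h₃⟩ | ⟨h, hu, hv⟩)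
    · refine ⟨a.succ, fun j => ?_, h₂, fun j => ?_⟩
      · induction j using Fin.cases with
        | zero => exact fun _ => h₀
        | succ j => exact fun hj => h₁ j (Fin.succ_lt_succ_iff.mp hj)
      · induction j using Fin.cases with
        | zero => exact fun hj => absurd hj (Fin.not_lt_zero _)
        | succ j => exact fun hj => h₃ j (Fin.succ_lt_succ_iff.mp hj)
    · refine ⟨0, fun j hj => absurd hj (Fin.not_lt_zero _), h, fun j => ?_⟩
      induction j using Fin.cases with
      | zero => exact fun hj => absurd hj (lt_irrefl _)
      | succ j => exact fun _ => ⟨congrFun hu j, congrFun hv j⟩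

end Sierpinski

end SimpleGraph

/-! ### Words as base-4 codes -/

/-- The number with base-4 digits given by the word `u`. -/
def wordCode : (n : ℕ) → (Fin n → Fin 4) → ℕ
  | 0, _ => 0
  | n + 1, u => (u 0).val * 4 ^ n + wordCode n (Fin.tail u)

/-- The code of the word `11…1` of length `n`. -/
def repunit : ℕ → ℕ
  | 0 => 0
  | n + 1 => 4 ^ n + repunit n

theorem wordCode_lt : ∀ (n : ℕ) (u : Fin n → Fin 4), wordCode n u < 4 ^ n
  | 0, _ => by simp [wordCode]
  | n + 1, u => by
    have h := wordCode_lt n (Fin.tail u)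
    have h0 : (u 0).val ≤ 3 := Nat.lt_succ_iff.mp (u 0).isLt
    have := Nat.mul_le_mul_right (4 ^ n) h0
    rw [wordCode, pow_succ]
    omega

theorem wordCode_injective : ∀ n : ℕ, Function.Injective (wordCode n)
  | 0 => fun _ _ _ => Subsingleton.elim _ _
  | n + 1 => fun u v h => by
    have hu := wordCode_lt n (Fin.tail u)
    have hv := wordCode_lt n (Fin.tail v)
    simp only [wordCode] at h
    have hpos : 0 < 4 ^ n := by positivity
    have h0 : (u 0).val = (v 0).val := by
      have hdiv : ∀ x t, t < 4 ^ n → (x * 4 ^ n + t) / 4 ^ n = x := fun x t ht => by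
        rw [add_comm, Nat.add_mul_div_right _ _ hpos, Nat.div_eq_of_lt ht, zero_add]
      rw [← hdiv (u 0).val _ hu, h, hdiv _ _ hv]
    rw [h0] at h
    have ht := wordCode_injective n (Nat.add_left_cancel h)
    rw [← Fin.cons_self_tail u, ← Fin.cons_self_tail v, Fin.ext h0, ht]

theorem exists_wordCode_eq : ∀ (n a : ℕ), a < 4 ^ n → ∃ u, wordCode n u = a
  | 0, a, h => ⟨Fin.elim0, by simp at h; simp [wordCode, h]⟩
  | n + 1, a, h => by
    have hpos : 0 < 4 ^ n := by positivity
    obtain ⟨u, hu⟩ := exists_wordCode_eq n (a % 4 ^ n) (Nat.mod_lt _ hpos)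
    have hd : a / 4 ^ n < 4 := by
      rw [Nat.div_lt_iff_lt_mul hpos]; rw [pow_succ] at h; omega
    refine ⟨Fin.cons ⟨a / 4 ^ n, hd⟩ u, ?_⟩
    rw [wordCode, Fin.cons_zero, Fin.tail_cons, hu]
    exact Nat.div_add_mod' a (4 ^ n)

theorem wordCode_const : ∀ (n : ℕ) (y : Fin 4), wordCode n (fun _ => y) = y.val * repunit n
  | 0, _ => rfl
  | n + 1, y => by
    have : (Fin.tail fun _ : Fin (n + 1) => y) = fun _ => y := rfl
    rw [wordCode, this, wordCode_const n y, repunit, mul_add]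

/-- The ordered pairs of adjacent vertices of `K₄ - e`. -/
def arcs : List (ℕ × ℕ) :=
  [(0, 1), (1, 0), (1, 2), (2, 1), (2, 3), (3, 2), (3, 0), (0, 3), (1, 3), (3, 1)]

theorem adj_iff_mem_arcs (x y : Fin 4) : K4MinusEdge.Adj x y ↔ (x.val, y.val) ∈ arcs := by
  simp only [K4MinusEdge, SimpleGraph.deleteEdges_adj, SimpleGraph.top_adj,
    Set.mem_singleton_iff, arcs]
  revert x y
  decide

theorem exists_of_mem_arcs {e : ℕ × ℕ} (h : e ∈ arcs) : ∃ x y : Fin 4, (x.val, y.val) = e := by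
  revert e
  decide

/-- The ordered pairs of codes of adjacent vertices of `S^n` over `K₄ - e`. -/
def codeArcs : ℕ → List (ℕ × ℕ)
  | 0 => []
  | n + 1 =>
    ((List.range 4).flatMap fun x =>
      (codeArcs n).map fun e => (x * 4 ^ n + e.1, x * 4 ^ n + e.2)) ++
    arcs.map fun e => (e.1 * 4 ^ n + e.2 * repunit n, e.2 * 4 ^ n + e.1 * repunit n)

theorem mem_codeArcs_of_adj : ∀ {n : ℕ} {u v : Fin n → Fin 4}, (K4MinusEdge.sierpinski n).Adj u v →
    (wordCode n u, wordCode n v) ∈ codeArcs n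
  | 0, u, v, h => h.choose.elim0
  | n + 1, u, v, h => by
    rw [codeArcs, List.mem_append]
    rcases SimpleGraph.sierpinski_adj_succ.mp h with ⟨h0, ht⟩ | ⟨h0, hu, hv⟩
    · refine .inl (List.mem_flatMap.mpr ⟨(u 0).val, List.mem_range.mpr (u 0).isLt,
        List.mem_map.mpr ⟨_, mem_codeArcs_of_adj ht, ?_⟩⟩)
      simp only [wordCode, h0]
    · refine .inr (List.mem_map.mpr ⟨_, (adj_iff_mem_arcs _ _).mp h0, ?_⟩)
      simp only [wordCode, hu, hv, wordCode_const]

theorem exists_adj_of_mem_codeArcs : ∀ {n : ℕ} {e : ℕ × ℕ}, e ∈ codeArcs n →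
    ∃ u v : Fin n → Fin 4, (K4MinusEdge.sierpinski n).Adj u v ∧ (wordCode n u, wordCode n v) = e
  | 0, e, h => by simp [codeArcs] at h
  | n + 1, e, h => by
    rw [codeArcs, List.mem_append] at h
    rcases h with h | h
    · obtain ⟨x, hx, h⟩ := List.mem_flatMap.mp h
      obtain ⟨e', he', rfl⟩ := List.mem_map.mp h
      obtain ⟨u, v, huv, rfl⟩ := exists_adj_of_mem_codeArcs he'
      let x' : Fin 4 := ⟨x, List.mem_range.mp hx⟩
      refine ⟨Fin.cons x' u, Fin.cons x' v, SimpleGraph.sierpinski_adj_succ.mpr (.inl ?_), ?_⟩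
      · simpa using huv
      · simp [wordCode, x']
    · obtain ⟨e', he', rfl⟩ := List.mem_map.mp h
      obtain ⟨x, y, rfl⟩ := exists_of_mem_arcs he'
      refine ⟨Fin.cons x fun _ => y, Fin.cons y fun _ => x,
        SimpleGraph.sierpinski_adj_succ.mpr (.inr ?_), ?_⟩
      · simpa using (adj_iff_mem_arcs x y).mpr he'
      · simp [wordCode, wordCode_const]

/-! ### Balls computed by shifting bits -/

/-- A family of moves on codes: a code `v` in `mask` moves to `v + left - right`. -/
structure Step where
  mask : ℕ
  left : ℕ
  right : ℕ

/-- The union of the set `S` of codes, given by its bits, and its images under the moves in `l`. -/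
def expand (l : List Step) (S : ℕ) : ℕ :=
  l.foldr (fun s T => T ||| (((S &&& s.mask) <<< s.left) >>> s.right)) S

/-- The codes that can be reached from `S` by at most `r` moves in `l`. -/
def reach (l : List Step) : ℕ → ℕ → ℕ
  | 0, S => S
  | r + 1, S => expand l (reach l r S)

/-- Along an edge from `w x y…y` to `w y x…x` with tail of length `t` the code changes by `(y - x) *
(4 ^ t - repunit t)`. This depends only on the position and the two letters, so a whole family of
edges is one masked shift. -/
theorem testBit_expand (l : List Step) (S w : ℕ) :
    (expand l S).testBit w ↔ S.testBit w ∨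
      ∃ s ∈ l, ∃ v, S.testBit v ∧ s.mask.testBit v ∧ v + s.left = w + s.right := by
  unfold expand
  induction l with
  | nil => simp
  | cons s l ih =>
    rw [List.foldr_cons, Nat.testBit_or, Bool.or_eq_true, ih]
    have : ((((S &&& s.mask) <<< s.left) >>> s.right).testBit w = true) ↔
        ∃ v, S.testBit v ∧ s.mask.testBit v ∧ v + s.left = w + s.right := by
      simp only [Nat.testBit_shiftRight, Nat.testBit_shiftLeft, Nat.testBit_and,
        Bool.and_eq_true, decide_eq_true_eq]
      constructor
      · rintro ⟨h, h1, h2⟩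
        exact ⟨_, h1, h2, by omega⟩
      · rintro ⟨v, h1, h2, h⟩
        have hv : s.right + w - s.left = v := by omega
        exact ⟨by omega, hv ▸ h1, hv ▸ h2⟩
    rw [this]
    simp only [List.mem_cons, exists_eq_or_imp]
    rw [or_assoc]
    exact or_congr_right or_comm

/-- The moves in `l` cover all the edges of `S^n` over `K₄ - e`. -/
def Covers (l : List Step) (n : ℕ) : Bool :=
  (codeArcs n).all fun e => l.any fun s =>
    s.mask.testBit e.1 && Nat.beq (e.1 + s.left) (e.2 + s.right)

/-- The moves in `l` follow edges of `S^n` over `K₄ - e`. -/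
def Follows (l : List Step) (n : ℕ) : Bool :=
  l.all fun s => (List.range (4 ^ n)).all fun a =>
    !s.mask.testBit a || (codeArcs n).any fun e =>
      Nat.beq e.1 a && Nat.beq (a + s.left) (e.2 + s.right)

theorem testBit_expand_of_adj {l : List Step} {n : ℕ} (hl : Covers l n) {S : ℕ}
    {u v : Fin n → Fin 4} (hu : S.testBit (wordCode n u))
    (huv : (K4MinusEdge.sierpinski n).Adj u v) : (expand l S).testBit (wordCode n v) := by
  have h := List.all_eq_true.mp hl _ (mem_codeArcs_of_adj huv)
  obtain ⟨s, hs, h⟩ := List.any_eq_true.mp h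
  rw [Bool.and_eq_true] at h
  exact (testBit_expand l S _).mpr (.inr ⟨s, hs, _, hu, h.1, Nat.eq_of_beq_eq_true h.2⟩)

theorem testBit_reach_of_le (l : List Step) (S v : ℕ) {r t : ℕ} (hrt : r ≤ t)
    (h : (reach l r S).testBit v) : (reach l t S).testBit v := by
  induction t, hrt using Nat.le_induction with
  | base => exact h
  | succ t _ ih => exact (testBit_expand l _ v).mpr (.inl ih)

theorem reach_succ' (l : List Step) (r S : ℕ) : reach l (r + 1) S = reach l r (expand l S) := by
  induction r with
  | zero => rfl
  | succ r ih => rw [reach, ih]; rfl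

theorem testBit_reach_of_walk {l : List Step} {n : ℕ} (hl : Covers l n)
    {u v : Fin n → Fin 4} (w : (K4MinusEdge.sierpinski n).Walk u v) {S : ℕ}
    (hu : S.testBit (wordCode n u)) : (reach l w.length S).testBit (wordCode n v) := by
  induction w generalizing S with
  | nil => exact hu
  | cons h w ih =>
    rw [SimpleGraph.Walk.length_cons, reach_succ']
    exact ih (testBit_expand_of_adj hl hu h)

/-- Computed balls contain the true ones. Superfluous moves are harmless here, as they only make the
checks of a coloring stricter. -/
theorem testBit_reach_of_edist_le {l : List Step} {n : ℕ} (hl : Covers l n)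
    {u v : Fin n → Fin 4} {r : ℕ} (h : (K4MinusEdge.sierpinski n).edist u v ≤ r) :
    (reach l r (1 <<< wordCode n u)).testBit (wordCode n v) := by
  obtain ⟨w, hw⟩ := SimpleGraph.exists_walk_of_edist_ne_top
    (ne_top_of_le_ne_top (ENat.natCast_ne_top r) h)
  rw [← hw] at h
  refine testBit_reach_of_le l _ _ (by exact_mod_cast h) (testBit_reach_of_walk hl w ?_)
  simp [Nat.shiftLeft_eq, Nat.testBit_two_pow_self]

/-- The converse inclusion, for lower bounds: a reached number is the code of a vertex that really
is within distance `r`. -/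
theorem edist_le_of_testBit_reach {l : List Step} {n : ℕ} (hl : Follows l n)
    {u : Fin n → Fin 4} : ∀ {r w : ℕ}, (reach l r (1 <<< wordCode n u)).testBit w →
    ∃ v, wordCode n v = w ∧ (K4MinusEdge.sierpinski n).edist u v ≤ r
  | 0, w, h => by
    rw [reach, Nat.one_shiftLeft, Nat.testBit_two_pow] at h
    exact ⟨u, of_decide_eq_true h, by simp⟩
  | r + 1, w, h => by
    rcases (testBit_expand l _ w).mp h with h | ⟨s, hs, a, ha, hm, haw⟩
    · obtain ⟨v, rfl, hv⟩ := edist_le_of_testBit_reach hl h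
      exact ⟨v, rfl, hv.trans (by simp)⟩
    · obtain ⟨v, rfl, hv⟩ := edist_le_of_testBit_reach hl ha
      have h1 := List.all_eq_true.mp hl s hs
      have h2 := List.all_eq_true.mp h1 _ (List.mem_range.mpr (wordCode_lt n v))
      rw [hm, Bool.not_true, Bool.false_or] at h2
      obtain ⟨e, he, h3⟩ := List.any_eq_true.mp h2
      rw [Bool.and_eq_true] at h3
      have h4 := Nat.eq_of_beq_eq_true h3.1
      have h5 := Nat.eq_of_beq_eq_true h3.2
      obtain ⟨v', w', hvw, rfl⟩ := exists_adj_of_mem_codeArcs he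
      obtain rfl := wordCode_injective n h4
      refine ⟨w', by simp only at h5; omega, (SimpleGraph.edist_triangle (v := v')).trans ?_⟩
      rw [SimpleGraph.edist_eq_one_iff_adj.mpr hvw, Nat.cast_add, Nat.cast_one]
      gcongr

/-! ### Checks for colorings given by their color classes -/

/-- The color of the code `a` in the coloring with the list `L` of color classes. -/
def classColor (L : List ℕ) (a : ℕ) : ℕ :=
  L.findIdx (fun C => C.testBit a) + 1

/-- The lists of color classes that are packing colorings of `S^n` with moves `l`. -/
def IsPackingClasses (l : List Step) (n : ℕ) (L : List ℕ) : Bool :=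
  (List.range (4 ^ n)).all fun a => L.any (fun C => C.testBit a) &&
    (List.range L.length).all fun i =>
      !(L.getD i 0).testBit a || Nat.beq (reach l (i + 1) (1 <<< a) &&& L.getD i 0) (1 <<< a)

theorem testBit_of_classColor_eq {L : List ℕ} {a i : ℕ} (h : classColor L a = i + 1)
    (hi : i < L.length) : (L.getD i 0).testBit a := by
  have h' : L.findIdx (fun C => C.testBit a) = i := Nat.succ_injective h
  subst h'
  rw [List.getD_eq_getElem _ _ hi]
  exact List.findIdx_getElem (w := hi)

theorem isPackingColoring_of_classes {l : List Step} {n : ℕ} {L : List ℕ} (hl : Covers l n)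
    (hL : IsPackingClasses l n L) : (K4MinusEdge.sierpinski n).IsPackingColoring L.length
      fun u => classColor L (wordCode n u) := by
  have h : ∀ u, _ := fun u => List.all_eq_true.mp hL _ (List.mem_range.mpr (wordCode_lt n u))
  simp only [Bool.and_eq_true] at h
  refine ⟨fun u => ⟨Nat.le_add_left _ _, ?_⟩, fun i hi hik u hu v hv huv => ?_⟩
  · exact List.findIdx_lt_length_of_exists (List.any_eq_true.mp (h u).1)
  · obtain ⟨i, rfl⟩ := Nat.exists_eq_succ_of_ne_zero (Nat.pos_iff_ne_zero.mp hi)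
    by_contra hlt
    have h1 := testBit_reach_of_edist_le hl (not_lt.mp hlt)
    have h2 := List.all_eq_true.mp (h u).2 i (List.mem_range.mpr hik)
    rw [testBit_of_classColor_eq hu hik, Bool.not_true, Bool.false_or] at h2
    have h3 := congrArg (fun S => S.testBit (wordCode n v)) (Nat.eq_of_beq_eq_true h2)
    simp only [Nat.testBit_and, testBit_of_classColor_eq hv hik, Bool.and_true, Nat.one_shiftLeft,
      Nat.testBit_two_pow] at h3
    rw [Nat.one_shiftLeft] at h1
    rw [h1] at h3
    exact huv (wordCode_injective n (of_decide_eq_true h3.symm))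

/-- No two vertices of the same color are too close across an edge between two blocks. -/
def IsCrossCompatible (l : List Step) (n : ℕ) (L : List ℕ) : Bool :=
  arcs.all fun e => (List.range L.length).all fun i => (List.range (i + 1)).all fun r =>
    Nat.beq (reach l r (1 <<< (e.1 * repunit n)) &&& L.getD i 0) 0 ||
      Nat.beq (reach l (i - r) (1 <<< (e.2 * repunit n)) &&& L.getD i 0) 0

/-- The corners of `S^n` are at distance at least `k`. -/
def AreCornersFar (l : List Step) (n k : ℕ) : Bool :=
  (List.range 4).all fun i => (List.range 4).all fun j =>
    Nat.beq i j || !(reach l (k - 1) (1 <<< (i * repunit n))).testBit (j * repunit n)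

theorem le_edist_const {l : List Step} {n k : ℕ} (hl : Covers l n) (h : AreCornersFar l n (k + 1))
    {i j : Fin 4} (hij : i ≠ j) :
    ((k + 1 : ℕ) : ℕ∞) ≤ (K4MinusEdge.sierpinski n).edist (fun _ => i) (fun _ => j) := by
  by_contra hlt
  rw [not_le, Nat.cast_add, Nat.cast_one] at hlt
  have h1 := testBit_reach_of_edist_le hl (ENat.lt_add_one_iff (by simp) |>.mp hlt)
  have h2 := List.all_eq_true.mp (List.all_eq_true.mp h i.val (List.mem_range.mpr i.isLt)) j.val
    (List.mem_range.mpr j.isLt)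
  rw [wordCode_const, wordCode_const] at h1
  rw [Nat.add_sub_cancel, h1, Bool.not_true, Bool.or_false] at h2
  exact hij (Fin.ext (Nat.eq_of_beq_eq_true h2))

/-- The class with index `k` has color `k + 1`. A conflict across an edge splits as `r + 1 + s ≤ k +
1`, so it suffices to test, for each `r ≤ k`, the balls of radii `r` and `k - r` about the two
corners. -/
theorem lt_edist_add_edist {l : List Step} {n : ℕ} {L : List ℕ} (hl : Covers l n)
    (hL : IsPackingClasses l n L) (hc : IsCrossCompatible l n L) {i j : Fin 4}
    (hij : K4MinusEdge.Adj i j) {u v : Fin n → Fin 4}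
    (huv : classColor L (wordCode n u) = classColor L (wordCode n v)) :
    (classColor L (wordCode n u) : ℕ∞) <
      (K4MinusEdge.sierpinski n).edist u (fun _ => i) + 1 +
        (K4MinusEdge.sierpinski n).edist (fun _ => j) v := by
  obtain ⟨k, hk⟩ : ∃ k, classColor L (wordCode n u) = k + 1 := ⟨_, rfl⟩
  have hkL : k < L.length := by
    have := ((isPackingColoring_of_classes hl hL).1 u).2
    simp only [hk] at this
    exact this
  by_contra hlt
  rw [not_lt, hk] at hlt
  rw [SimpleGraph.edist_comm] at hlt
  obtain ⟨r, hr⟩ := ENat.ne_top_iff_exists.mp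
    (ne_top_of_le_ne_top (ENat.natCast_ne_top _) ((le_add_right (le_add_right le_rfl)).trans hlt))
  obtain ⟨s, hs⟩ := ENat.ne_top_iff_exists.mp
    (ne_top_of_le_ne_top (ENat.natCast_ne_top _) ((le_add_left le_rfl).trans hlt))
  rw [← hr, ← hs] at hlt
  have hrs : r + 1 + s ≤ k + 1 := by exact_mod_cast hlt
  have h1 := testBit_reach_of_edist_le hl hr.ge
  have h2 := testBit_reach_of_le _ _ _ (show s ≤ k - r by omega)
    (testBit_reach_of_edist_le hl hs.ge)
  have h3 := List.all_eq_true.mp (List.all_eq_true.mp (List.all_eq_true.mp hc _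
    ((adj_iff_mem_arcs i j).mp hij)) k (List.mem_range.mpr hkL)) r (List.mem_range.mpr (by omega))
  rw [wordCode_const] at h1 h2
  rcases Bool.or_eq_true _ _ ▸ h3 with h3 | h3
  · have h4 := congrArg (fun S => S.testBit (wordCode n u)) (Nat.eq_of_beq_eq_true h3)
    simp [-List.getD_eq_getElem?_getD, h1, testBit_of_classColor_eq hk hkL] at h4
  · have h4 := congrArg (fun S => S.testBit (wordCode n v)) (Nat.eq_of_beq_eq_true h3)
    simp [-List.getD_eq_getElem?_getD, h2, testBit_of_classColor_eq (huv ▸ hk) hkL] at h4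
-- Explicit colorings and the upper bounds
/-- The moves along the edges of `S^4`, by the position of the edge and its two letters. -/
def blockSteps : List Step :=
  [⟨0x1111111111111111111111111111111111111111111111111111111111111111, 1, 0⟩,
   ⟨0x2222222222222222222222222222222222222222222222222222222222222222, 0, 1⟩,
   ⟨0x2222222222222222222222222222222222222222222222222222222222222222, 1, 0⟩,
   ⟨0x4444444444444444444444444444444444444444444444444444444444444444, 0, 1⟩,
   ⟨0x4444444444444444444444444444444444444444444444444444444444444444, 1, 0⟩,
   ⟨0x8888888888888888888888888888888888888888888888888888888888888888, 0, 1⟩,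
   ⟨0x8888888888888888888888888888888888888888888888888888888888888888, 0, 3⟩,
   ⟨0x1111111111111111111111111111111111111111111111111111111111111111, 3, 0⟩,
   ⟨0x2222222222222222222222222222222222222222222222222222222222222222, 2, 0⟩,
   ⟨0x8888888888888888888888888888888888888888888888888888888888888888, 0, 2⟩,
   ⟨0x2000200020002000200020002000200020002000200020002000200020002, 3, 0⟩,
   ⟨0x10001000100010001000100010001000100010001000100010001000100010, 0, 3⟩,
   ⟨0x40004000400040004000400040004000400040004000400040004000400040, 3, 0⟩,
   ⟨0x200020002000200020002000200020002000200020002000200020002000200, 0, 3⟩,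
   ⟨0x800080008000800080008000800080008000800080008000800080008000800, 3, 0⟩,
   ⟨0x4000400040004000400040004000400040004000400040004000400040004000, 0, 3⟩,
   ⟨0x1000100010001000100010001000100010001000100010001000100010001000, 0, 9⟩,
   ⟨0x8000800080008000800080008000800080008000800080008000800080008, 9, 0⟩,
   ⟨0x80008000800080008000800080008000800080008000800080008000800080, 6, 0⟩,
   ⟨0x2000200020002000200020002000200020002000200020002000200020002000, 0, 6⟩,
   ⟨0x20000000000000002000000000000000200000000000000020, 11, 0⟩,
   ⟨0x10000000000000001000000000000000100000000000000010000, 0, 11⟩,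
   ⟨0x4000000000000000400000000000000040000000000000004000000, 11, 0⟩,
   ⟨0x2000000000000000200000000000000020000000000000002000000000, 0, 11⟩,
   ⟨0x800000000000000080000000000000008000000000000000800000000000, 11, 0⟩,
   ⟨0x400000000000000040000000000000004000000000000000400000000000000, 0, 11⟩,
   ⟨0x1000000000000000100000000000000010000000000000001000000000000, 0, 33⟩,
   ⟨0x8000000000000000800000000000000080000000000000008000, 33, 0⟩,
   ⟨0x80000000000000008000000000000000800000000000000080000000, 22, 0⟩,
   ⟨0x20000000000000002000000000000000200000000000000020000000000000, 0, 22⟩,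
   ⟨0x200000, 43, 0⟩,
   ⟨0x10000000000000000, 0, 43⟩,
   ⟨0x400000000000000000000000000, 43, 0⟩,
   ⟨0x20000000000000000000000000000000000000, 0, 43⟩,
   ⟨0x800000000000000000000000000000000000000000000000, 43, 0⟩,
   ⟨0x40000000000000000000000000000000000000000000000000000000000, 0, 43⟩,
   ⟨0x1000000000000000000000000000000000000000000000000, 0, 129⟩,
   ⟨0x8000000000000000, 129, 0⟩,
   ⟨0x80000000000000000000000000000000, 86, 0⟩,
   ⟨0x200000000000000000000000000000000000000000000000000000, 0, 86⟩]

/-- The color classes of a packing coloring of `S^1`. -/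
def classes1 : List ℕ := [5, 2, 8]

/-- The color classes of a packing coloring of `S^2`. -/
def classes2 : List ℕ :=
  [0x5555, 0x2202, 0x808, 0x20, 0x80, 0x8000]

/-- The color classes of a packing coloring of `S^3`. -/
def classes3 : List ℕ :=
  [0x5555555555555555, 0x2202220282020888, 0x808080808080202, 0x8000008000802000, 0x80002000000020,
   0x800000208000, 0x20000000000000, 0x20000000]

/-- The color classes of a packing coloring of `S^4` that can be repeated on all the blocks
of a larger Sierpiński graph. -/
def classes4 : List ℕ :=
  [0x5555555555555555255555558555555555555555555555552555528288555555,
   0x2202220222022202088822020888220222020888088808884028812101882202,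
   0x808002000800020120008081200008008080202020202028000004840020808,
   0x80008000200080400000802000800000008000800080000802040402000020,
   0x80000008800000200000080000800020000000200000200020008000,
   0x80000080000000000000020000800000000002000001000080000200000,
   0x800000008000000080000002000080000000000000000000000004000080,
   0x8000800002000000000000000000000200000000000000010000000,
   0x20000000000000000200000000000000002000000020000200000000000000,
   0x800000000000000004000000000200000000000000080000000000000,
   0x8000000000000000000000000000002000000000000000000000001000000000]

/-- The moves of `S^4` also serve the smaller graphs: those leading out of the range of codes only
enlarge the computed balls. -/
theorem covers_blockSteps_one : Covers blockSteps 1 := by decide +kernel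

theorem covers_blockSteps_two : Covers blockSteps 2 := by decide +kernel

theorem covers_blockSteps_three : Covers blockSteps 3 := by decide +kernel

theorem covers_blockSteps_four : Covers blockSteps 4 := by decide +kernel

theorem isPackingClasses_one : IsPackingClasses blockSteps 1 classes1 := by decide +kernel

theorem isPackingClasses_two : IsPackingClasses blockSteps 2 classes2 := by decide +kernel

theorem isPackingClasses_three : IsPackingClasses blockSteps 3 classes3 := by decide +kernel

theorem isPackingClasses_four : IsPackingClasses blockSteps 4 classes4 := by decide +kernel

theorem isCrossCompatible_four : IsCrossCompatible blockSteps 4 classes4 := by decide +kernel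

theorem areCornersFar_four : AreCornersFar blockSteps 4 11 := by decide +kernel

theorem isPackingColoring_block (m : ℕ) : (K4MinusEdge.sierpinski (m + 4)).IsPackingColoring 11
    fun u => classColor classes4 (wordCode 4 (SimpleGraph.suf m 4 u)) :=
  (isPackingColoring_of_classes covers_blockSteps_four isPackingClasses_four).suffix
    (fun _ _ => le_edist_const covers_blockSteps_four areCornersFar_four)
    (fun _ _ h _ _ => lt_edist_add_edist covers_blockSteps_four isPackingClasses_four
      isCrossCompatible_four h) m

/-! ### Lower bounds: a search that refutes five colors -/

open SimpleGraph

/-- A `k`-packing coloring of `S^n` over `K₄ - e`, as a function of the codes. -/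
def IsCodeColoring (l : List Step) (n k : ℕ) (f : ℕ → ℕ) : Prop :=
  (∀ a < 4 ^ n, 1 ≤ f a ∧ f a ≤ k) ∧
    ∀ a < 4 ^ n, ∀ w, (reach l (f a) (1 <<< a)).testBit w → f w = f a → w = a

theorem exists_isCodeColoring {l : List Step} {n k : ℕ} (hl : Follows l n)
    {c : (Fin n → Fin 4) → ℕ} (hc : (K4MinusEdge.sierpinski n).IsPackingColoring k c) :
    ∃ f, IsCodeColoring l n k f := by
  have hf : ∀ u, c (Function.invFun (wordCode n) (wordCode n u)) = c u := fun u => by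
    rw [Function.leftInverse_invFun (wordCode_injective n) u]
  refine ⟨fun a => c (Function.invFun (wordCode n) a), fun a ha => ?_, fun a ha w hw h => ?_⟩ <;>
    obtain ⟨u, rfl⟩ := exists_wordCode_eq n a ha
  · simp only [hf]
    exact hc.1 u
  · simp only [hf] at hw h
    obtain ⟨v, rfl, hv⟩ := edist_le_of_testBit_reach hl hw
    rw [hf] at h
    by_contra hne
    exact absurd hv (not_le.mpr (hc.2 _ (hc.1 u).1 (hc.1 u).2 u rfl v h fun huv => hne (by rw [huv])))

/-- A vertex `vertex` and, for each of the colors `1, …, 5`, a set of vertices that cannot have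
this color together with `vertex`. -/
structure Row where
  vertex : ℕ
  ban1 : ℕ
  ban2 : ℕ
  ban3 : ℕ
  ban4 : ℕ
  ban5 : ℕ

/-- The bit `v` of `b` is zero. -/
def isFree (b v : ℕ) : Bool := Nat.beq (Nat.land (Nat.shiftRight b v) 1) 0

theorem isFree_eq (b v : ℕ) : isFree b v = !b.testBit v := by
  rw [Bool.eq_iff_iff, isFree, Nat.beq_eq]
  change (b >>> v) &&& 1 = 0 ↔ _
  simp [Nat.testBit, Nat.and_comm 1]

/-- Depth-first search showing that the vertices in `X` cannot be colored with `1, …, 5`, where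
the vertices in `bᵢ` do not have the color `i`. -/
noncomputable def refute (X : ℕ) (l : List Row) : ℕ → ℕ → ℕ → ℕ → ℕ → Bool :=
  List.rec (fun _ _ _ _ _ => false)
    (fun r _ k b₁ b₂ b₃ b₄ b₅ =>
      cond (Nat.beq (Nat.land X (Nat.land b₁ (Nat.land b₂ (Nat.land b₃ (Nat.land b₄ b₅))))) 0)
        (cond (isFree X r.vertex) (k b₁ b₂ b₃ b₄ b₅)
          (cond (cond (isFree b₁ r.vertex) (k (Nat.lor b₁ r.ban1) b₂ b₃ b₄ b₅) true)
            (cond (cond (isFree b₂ r.vertex) (k b₁ (Nat.lor b₂ r.ban2) b₃ b₄ b₅) true)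
              (cond (cond (isFree b₃ r.vertex) (k b₁ b₂ (Nat.lor b₃ r.ban3) b₄ b₅) true)
                (cond (cond (isFree b₄ r.vertex) (k b₁ b₂ b₃ (Nat.lor b₄ r.ban4) b₅) true)
                  (cond (isFree b₅ r.vertex) (k b₁ b₂ b₃ b₄ (Nat.lor b₅ r.ban5)) true)
                  false) false) false) false))
        true) l

/-- The invariant is that no vertex in `bᵢ` has color `i`. Given an actual coloring `f`, the branch
that follows `f` is never closed. The rows need not exhaust `X`. -/
theorem refute_sound {f : ℕ → ℕ} {X : ℕ} (hX : ∀ w, X.testBit w → 1 ≤ f w ∧ f w ≤ 5) :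
    ∀ (l : List Row), (∀ r ∈ l, ∀ w,
      (r.ban1.testBit w → f r.vertex = 1 → f w ≠ 1) ∧
      (r.ban2.testBit w → f r.vertex = 2 → f w ≠ 2) ∧
      (r.ban3.testBit w → f r.vertex = 3 → f w ≠ 3) ∧
      (r.ban4.testBit w → f r.vertex = 4 → f w ≠ 4) ∧
      (r.ban5.testBit w → f r.vertex = 5 → f w ≠ 5)) →
    ∀ b₁ b₂ b₃ b₄ b₅ : ℕ, (∀ w, b₁.testBit w → f w ≠ 1) → (∀ w, b₂.testBit w → f w ≠ 2) →
      (∀ w, b₃.testBit w → f w ≠ 3) → (∀ w, b₄.testBit w → f w ≠ 4) →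
      (∀ w, b₅.testBit w → f w ≠ 5) → refute X l b₁ b₂ b₃ b₄ b₅ = false
  | [], _, _, _, _, _, _, _, _, _, _, _ => rfl
  | r :: l, hl, b₁, b₂, b₃, b₄, b₅, h₁, h₂, h₃, h₄, h₅ => by
    have ih := refute_sound hX l fun r hr => hl r (List.mem_cons_of_mem _ hr)
    have hr := hl r List.mem_cons_self
    have hor : ∀ {i b B : ℕ}, (∀ w, b.testBit w → f w ≠ i) → (∀ w, B.testBit w → f w ≠ i) →
        ∀ w, (Nat.lor b B).testBit w → f w ≠ i := fun {i b B} hb hB w hw => by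
      change (b ||| B).testBit w = true at hw
      rw [Nat.testBit_or, Bool.or_eq_true] at hw
      exact hw.elim (hb w) (hB w)
    -- A vertex of `X` in all five banned sets would have no color left.
    have hempty : Nat.land X (Nat.land b₁ (Nat.land b₂ (Nat.land b₃ (Nat.land b₄ b₅)))) = 0 := by
      change X &&& (b₁ &&& (b₂ &&& (b₃ &&& (b₄ &&& b₅)))) = 0
      refine Nat.eq_of_testBit_eq fun w => ?_
      rw [Nat.zero_testBit, Bool.eq_false_iff]
      intro hw
      simp only [Nat.testBit_and, Bool.and_eq_true] at hw
      obtain ⟨h0, w1, w2, w3, w4, w5⟩ := hw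
      have := hX w h0
      have := h₁ w w1
      have := h₂ w w2
      have := h₃ w w3
      have := h₄ w w4
      have := h₅ w w5
      omega
    -- The branch for the actual color of the vertex is open, because that color is not banned
    -- there.
    have key : ∀ {i b : ℕ} {t : Bool}, (∀ w, b.testBit w → f w ≠ i) → f r.vertex = i → t = false →
        cond (isFree b r.vertex) t true = false := fun {i b t} hb hi ht => by
      rw [isFree_eq, Bool.eq_false_iff.mpr fun h => hb _ h hi, ht]
      rfl
    have hfold : refute X (r :: l) b₁ b₂ b₃ b₄ b₅ = _ := rfl
    rw [hfold]
    change cond (Nat.beq _ 0) (cond (isFree X r.vertex) (refute X l b₁ b₂ b₃ b₄ b₅)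
          (cond (cond (isFree b₁ r.vertex) (refute X l (Nat.lor b₁ r.ban1) b₂ b₃ b₄ b₅) true)
            (cond (cond (isFree b₂ r.vertex) (refute X l b₁ (Nat.lor b₂ r.ban2) b₃ b₄ b₅) true)
              (cond (cond (isFree b₃ r.vertex) (refute X l b₁ b₂ (Nat.lor b₃ r.ban3) b₄ b₅) true)
                (cond (cond (isFree b₄ r.vertex) (refute X l b₁ b₂ b₃ (Nat.lor b₄ r.ban4) b₅) true)
                  (cond (isFree b₅ r.vertex) (refute X l b₁ b₂ b₃ b₄ (Nat.lor b₅ r.ban5)) true)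
                  false) false) false) false)) true = false
    rw [hempty, show Nat.beq 0 0 = true from rfl, cond_true]
    by_cases hv : X.testBit r.vertex
    · rw [isFree_eq X, hv, Bool.not_true, cond_false]
      obtain ⟨hv1, hv5⟩ := hX _ hv
      obtain h | h | h | h | h : f r.vertex = 1 ∨ f r.vertex = 2 ∨ f r.vertex = 3 ∨
        f r.vertex = 4 ∨ f r.vertex = 5 := by omega
      · rw [key h₁ h (ih _ _ _ _ _ (hor h₁ fun w hw => (hr w).1 hw h) h₂ h₃ h₄ h₅)]
        rfl
      · rw [key h₂ h (ih _ _ _ _ _ h₁ (hor h₂ fun w hw => (hr w).2.1 hw h) h₃ h₄ h₅)]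
        simp only [cond_false, Bool.cond_self]
      · rw [key h₃ h (ih _ _ _ _ _ h₁ h₂ (hor h₃ fun w hw => (hr w).2.2.1 hw h) h₄ h₅)]
        simp only [cond_false, Bool.cond_self]
      · rw [key h₄ h (ih _ _ _ _ _ h₁ h₂ h₃ (hor h₄ fun w hw => (hr w).2.2.2.1 hw h) h₅)]
        simp only [cond_false, Bool.cond_self]
      · rw [key h₅ h (ih _ _ _ _ _ h₁ h₂ h₃ h₄ (hor h₅ fun w hw => (hr w).2.2.2.2 hw h))]
        simp only [Bool.cond_self]
    · rw [isFree_eq X, Bool.eq_false_iff.mpr hv, Bool.not_false, cond_true]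
      exact ih _ _ _ _ _ h₁ h₂ h₃ h₄ h₅

/-- The set `B` contains only vertices other than `v` at distance at most `i` from `v`, all
vertices being shifted by `o`. -/
def IsBan (l : List Step) (o v i B : ℕ) : Bool :=
  Nat.beq ((B <<< o) &&& reach l i (1 <<< (o + v))) (B <<< o) && !B.testBit v

/-- The sets in the rows, shifted by `o`, consist of vertices that are too close for the color. -/
def RowsFollow (l : List Step) (n o : ℕ) (rows : List Row) : Bool :=
  rows.all fun r => Nat.blt (o + r.vertex) (4 ^ n) && (IsBan l o r.vertex 1 r.ban1 &&
    (IsBan l o r.vertex 2 r.ban2 && (IsBan l o r.vertex 3 r.ban3 &&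
      (IsBan l o r.vertex 4 r.ban4 && IsBan l o r.vertex 5 r.ban5))))

theorem IsCodeColoring.ne_of_isBan {l : List Step} {n k o v i B w : ℕ} {f : ℕ → ℕ}
    (hf : IsCodeColoring l n k f) (hv : o + v < 4 ^ n) (hB : IsBan l o v i B) (hw : B.testBit w)
    (hi : f (o + v) = i) : f (o + w) ≠ i := fun h => by
  rw [IsBan, Bool.and_eq_true, Bool.not_eq_true'] at hB
  have h1 := congrArg (fun S => S.testBit (o + w)) (Nat.eq_of_beq_eq_true hB.1)
  simp only [Nat.testBit_and, Nat.testBit_shiftLeft, Nat.add_sub_cancel_left, hw,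
    Nat.le_add_right, decide_true, Bool.true_and] at h1
  have h2 := hf.2 _ hv (o + w) (by rw [hi]; exact h1) (h.trans hi.symm)
  rw [Nat.add_left_cancel h2, hB.2] at hw
  exact Bool.false_ne_true hw

theorem IsCodeColoring.refute_eq_false {l : List Step} {n k o : ℕ} {f : ℕ → ℕ}
    (hf : IsCodeColoring l n k f) {rows : List Row} (hrows : RowsFollow l n o rows) {X : ℕ}
    (hX : ∀ w, X.testBit w → 1 ≤ f (o + w) ∧ f (o + w) ≤ 5) :
    refute X rows 0 0 0 0 0 = false := by
  refine refute_sound (f := fun w => f (o + w)) hX rows (fun r hr w => ?_) 0 0 0 0 0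
    (by simp) (by simp) (by simp) (by simp) (by simp)
  have h := List.all_eq_true.mp hrows r hr
  simp only [Bool.and_eq_true, Nat.blt_eq] at h
  obtain ⟨hv, h1, h2, h3, h4, h5⟩ := h
  exact ⟨hf.ne_of_isBan hv h1, hf.ne_of_isBan hv h2, hf.ne_of_isBan hv h3, hf.ne_of_isBan hv h4,
    hf.ne_of_isBan hv h5⟩

/-! ### Data for the searches in `S^2` and `S^3` -/

/-- The moves along the edges of `S^2`. -/
def squareSteps : List Step :=
  [⟨0x1111, 1, 0⟩,
   ⟨0x2222, 0, 1⟩,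
   ⟨0x2222, 1, 0⟩,
   ⟨0x4444, 0, 1⟩,
   ⟨0x4444, 1, 0⟩,
   ⟨0x8888, 0, 1⟩,
   ⟨0x8888, 0, 3⟩,
   ⟨0x1111, 3, 0⟩,
   ⟨0x2222, 2, 0⟩,
   ⟨0x8888, 0, 2⟩,
   ⟨0x2, 3, 0⟩,
   ⟨0x10, 0, 3⟩,
   ⟨0x40, 3, 0⟩,
   ⟨0x200, 0, 3⟩,
   ⟨0x800, 3, 0⟩,
   ⟨0x4000, 0, 3⟩,
   ⟨0x1000, 0, 9⟩,
   ⟨0x8, 9, 0⟩,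
   ⟨0x80, 6, 0⟩,
   ⟨0x2000, 0, 6⟩]

/-- The moves along the edges of `S^3`. -/
def cubeSteps : List Step :=
  [⟨0x1111111111111111, 1, 0⟩,
   ⟨0x2222222222222222, 0, 1⟩,
   ⟨0x2222222222222222, 1, 0⟩,
   ⟨0x4444444444444444, 0, 1⟩,
   ⟨0x4444444444444444, 1, 0⟩,
   ⟨0x8888888888888888, 0, 1⟩,
   ⟨0x8888888888888888, 0, 3⟩,
   ⟨0x1111111111111111, 3, 0⟩,
   ⟨0x2222222222222222, 2, 0⟩,
   ⟨0x8888888888888888, 0, 2⟩,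
   ⟨0x2000200020002, 3, 0⟩,
   ⟨0x10001000100010, 0, 3⟩,
   ⟨0x40004000400040, 3, 0⟩,
   ⟨0x200020002000200, 0, 3⟩,
   ⟨0x800080008000800, 3, 0⟩,
   ⟨0x4000400040004000, 0, 3⟩,
   ⟨0x1000100010001000, 0, 9⟩,
   ⟨0x8000800080008, 9, 0⟩,
   ⟨0x80008000800080, 6, 0⟩,
   ⟨0x2000200020002000, 0, 6⟩,
   ⟨0x20, 11, 0⟩,
   ⟨0x10000, 0, 11⟩,
   ⟨0x4000000, 11, 0⟩,
   ⟨0x2000000000, 0, 11⟩,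
   ⟨0x800000000000, 11, 0⟩,
   ⟨0x400000000000000, 0, 11⟩,
   ⟨0x1000000000000, 0, 33⟩,
   ⟨0x8000, 33, 0⟩,
   ⟨0x80000000, 22, 0⟩,
   ⟨0x20000000000000, 0, 22⟩]

/-- The vertices of `S^2` in the order of the search. -/
def squareRows : List Row :=
  [⟨14, 0xa800, 0xbf80, 0xbff8, 0xbfff, 0xbfff⟩,
   ⟨15, 0x7000, 0x7888, 0x7fff, 0x7fff, 0x7fff⟩,
   ⟨13, 0xd080, 0xd8f8, 0xdfff, 0xdfff, 0xdfff⟩,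
   ⟨7, 0x2070, 0xf272, 0xff7f, 0xff7f, 0xff7f⟩,
   ⟨6, 0x2a0, 0x2fb0, 0xffb2, 0xffbf, 0xffbf⟩,
   ⟨5, 0xd0, 0x22d2, 0xffdf, 0xffdf, 0xffdf⟩,
   ⟨12, 0xa008, 0xe08f, 0xe8ff, 0xefff, 0xefff⟩,
   ⟨4, 0xa2, 0x20ef, 0xf2ef, 0xffef, 0xffef⟩,
   ⟨1, 0x1d, 0x10bd, 0xb0fd, 0xf2fd, 0xfffd⟩,
   ⟨3, 0x1007, 0xb017, 0xf0b7, 0xf8f7, 0xfff7⟩,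
   ⟨11, 0x4700, 0xe740, 0xf7e0, 0xf7f8, 0xf7ff⟩,
   ⟨9, 0xd40, 0x4de0, 0xedf0, 0xfdf2, 0xfdff⟩,
   ⟨10, 0xa00, 0x4b40, 0xebe0, 0xfbf0, 0xfbfa⟩,
   ⟨0, 0xa, 0x101e, 0xb0be, 0xf0fe, 0xfafe⟩,
   ⟨2, 0xa, 0x101b, 0xb0bb, 0xf0fb, 0xfafb⟩,
   ⟨8, 0xa00, 0x4e40, 0xeee0, 0xfef0, 0xfefa⟩]

/-- The vertices of the copies `1` and `3` of `S^2` in `S^3` in the order of the search. -/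
def cubeRows : List Row :=
  [⟨55, 0x2070000000000000, 0xf272000080000000, 0xff7f0000f0000000, 0xff7f0000f8880000, 0xff7f0000ffff0000⟩,
   ⟨52, 0xa2000000000000, 0x20ef000080000000, 0xf2ef0000f0000000, 0xffef0000f8880000, 0xffef0000ffff0000⟩,
   ⟨53, 0xd0000080000000, 0x22d20000f0000000, 0xffdf0000f8880000, 0xffdf0000ffff0000, 0xffdf0000ffff0000⟩,
   ⟨31, 0x20000070000000, 0xf0000078880000, 0x22f200007fff0000, 0xffff00007fff0000, 0xffff00007fff0000⟩,
   ⟨30, 0xa8000000, 0x200000bf800000, 0xf00000bff80000, 0x22f20000bfff0000, 0xffff0000bfff0000⟩,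
   ⟨29, 0xd0800000, 0x200000d8f80000, 0xf00000dfff0000, 0x22f20000dfff0000, 0xffff0000dfff0000⟩,
   ⟨28, 0xa0080000, 0x200000e08f0000, 0xf00000e8ff0000, 0x22f20000efff0000, 0xffff0000efff0000⟩,
   ⟨19, 0x10070000, 0xb0170000, 0x200000f0b70000, 0xf00000f8f70000, 0x22f20000fff70000⟩,
   ⟨23, 0x20700000, 0xf2720000, 0x200000ff7f0000, 0xf00000ff7f0000, 0x22f20000ff7f0000⟩,
   ⟨20, 0xa20000, 0x20ef0000, 0xf2ef0000, 0x200000ffef0000, 0xf00000ffef0000⟩,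
   ⟨17, 0x1d0000, 0x10bd0000, 0xb0fd0000, 0x200000f2fd0000, 0xf00000fffd0000⟩,
   ⟨18, 0xa0000, 0x101b0000, 0xb0bb0000, 0x200000f0fb0000, 0xf00000fafb0000⟩,
   ⟨21, 0xd00000, 0x22d20000, 0xffdf0000, 0x200000ffdf0000, 0xf00000ffdf0000⟩,
   ⟨22, 0x2a00000, 0x2fb00000, 0xffb20000, 0x200000ffbf0000, 0xf00000ffbf0000⟩,
   ⟨25, 0xd400000, 0x4de00000, 0xedf00000, 0x200000fdf20000, 0xf00000fdff0000⟩,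
   ⟨27, 0x47000000, 0xe7400000, 0x200000f7e00000, 0xf00000f7f80000, 0x22f20000f7ff0000⟩,
   ⟨54, 0x2a0000000000000, 0x2fb0000080000000, 0xffb20000f0000000, 0xffbf0000f8880000, 0xffbf0000ffff0000⟩,
   ⟨61, 0xd080000000000000, 0xd8f8000000000000, 0xdfff000080000000, 0xdfff0000f0000000, 0xdfff0000f8880000⟩,
   ⟨60, 0xa008000000000000, 0xe08f000000000000, 0xe8ff000000000000, 0xefff000080000000, 0xefff0000f0000000⟩,
   ⟨63, 0x7000000000000000, 0x7888000000000000, 0x7fff000000000000, 0x7fff000080000000, 0x7fff0000f0000000⟩,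
   ⟨62, 0xa800000000000000, 0xbf80000000000000, 0xbff8000000000000, 0xbfff000080000000, 0xbfff0000f0000000⟩,
   ⟨57, 0xd40000000000000, 0x4de0000000000000, 0xedf0000080000000, 0xfdf20000f0000000, 0xfdff0000f8880000⟩,
   ⟨59, 0x4700000000000000, 0xe740000000000000, 0xf7e0000000000000, 0xf7f8000080000000, 0xf7ff0000f0000000⟩,
   ⟨58, 0xa00000000000000, 0x4b40000000000000, 0xebe0000000000000, 0xfbf0000080000000, 0xfbfa0000f4000000⟩,
   ⟨49, 0x1d000000000000, 0x10bd000000000000, 0xb0fd000080000000, 0xf2fd0000f0000000, 0xfffd0000f8880000⟩,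
   ⟨51, 0x1007000000000000, 0xb017000000000000, 0xf0b7000000000000, 0xf8f7000080000000, 0xfff70000f0000000⟩,
   ⟨50, 0xa000000000000, 0x101b000000000000, 0xb0bb000000000000, 0xf0fb000080000000, 0xfafb0000f0000000⟩,
   ⟨48, 0xa000000000000, 0x101e000000000000, 0xb0be000000000000, 0xf0fe000080000000, 0xfafe0000f0010000⟩,
   ⟨24, 0xa000000, 0x4e400000, 0xeee00000, 0x200000fef00000, 0xf00000fefa0000⟩,
   ⟨56, 0xa00000000000000, 0x4e40000000000000, 0xeee0000000000000, 0xfef0000080000000, 0xfefa0000f0000000⟩,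
   ⟨26, 0xa000000, 0x4b400000, 0xebe00000, 0x200000fbf00000, 0x4f00000fbfa0000⟩,
   ⟨16, 0xa0000, 0x101e0000, 0xb0be0000, 0x200000f0fe0000, 0xf10000fafe0000⟩]

/-- The possible positions of the colors `6` and `7` in a copy of `S^2`, where `16` means that
the color does not occur. -/
def options : List (ℕ × ℕ) :=
  [(0, 5), (0, 6), (0, 7), (0, 13), (0, 14), (0, 15), (1, 5), (1, 6), (1, 7), (1, 9), (1, 11),
   (1, 13), (1, 14), (1, 15), (2, 5), (2, 6), (2, 7), (2, 13), (2, 14), (2, 15), (3, 5), (3, 6),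
   (3, 7), (3, 9), (3, 11), (3, 13), (3, 14), (3, 15), (4, 5), (4, 6), (4, 7), (4, 8), (4, 9),
   (4, 10), (4, 11), (4, 13), (4, 15), (5, 0), (5, 1), (5, 2), (5, 3), (5, 4), (5, 6), (5, 7),
   (5, 8), (5, 9), (5, 10), (5, 11), (5, 12), (5, 13), (5, 14), (5, 15), (5, 16), (6, 0), (6, 1),
   (6, 2), (6, 3), (6, 4), (6, 5), (6, 7), (6, 13), (6, 15), (7, 0), (7, 1), (7, 2), (7, 3),
   (7, 4), (7, 5), (7, 6), (7, 8), (7, 9), (7, 10), (7, 11), (7, 12), (7, 13), (7, 14), (7, 15),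
   (7, 16), (8, 4), (8, 5), (8, 7), (8, 12), (8, 13), (8, 15), (9, 1), (9, 3), (9, 4), (9, 5),
   (9, 7), (9, 12), (9, 13), (9, 15), (10, 4), (10, 5), (10, 7), (10, 12), (10, 13), (10, 15),
   (11, 1), (11, 3), (11, 4), (11, 5), (11, 7), (11, 12), (11, 13), (11, 15), (12, 5), (12, 7),
   (12, 8), (12, 9), (12, 10), (12, 11), (12, 13), (12, 14), (12, 15), (13, 0), (13, 1), (13, 2),
   (13, 3), (13, 4), (13, 5), (13, 6), (13, 7), (13, 8), (13, 9), (13, 10), (13, 11), (13, 12),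
   (13, 14), (13, 15), (13, 16), (14, 0), (14, 1), (14, 2), (14, 3), (14, 5), (14, 7), (14, 12),
   (14, 13), (14, 15), (15, 0), (15, 1), (15, 2), (15, 3), (15, 4), (15, 5), (15, 6), (15, 7),
   (15, 8), (15, 9), (15, 10), (15, 11), (15, 12), (15, 13), (15, 14), (15, 16), (16, 5), (16, 7),
   (16, 13), (16, 15)]

/-- Sets of two vertices of `S^2` whose complement has no packing coloring with the colors
`1, …, 5`. -/
def squareExceptions : List ℕ :=
  [0x3, 0x5, 0x6, 0x9, 0xa, 0xc, 0x11, 0x12, 0x14, 0x18, 0x101, 0x102, 0x104, 0x108, 0x140, 0x201,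
   0x204, 0x240, 0x300, 0x401, 0x402, 0x404, 0x408, 0x440, 0x500, 0x600, 0x801, 0x804, 0x840,
   0x900, 0xa00, 0xc00, 0x1001, 0x1002, 0x1004, 0x1008, 0x1010, 0x1040, 0x4010, 0x4040, 0x4100,
   0x4200, 0x4400, 0x4800]

/-- Sets of vertices whose complement in the copies `1` and `3` of `S^2` in `S^3` has no packing
coloring with the colors `1, …, 5`. -/
def cubeExceptions : List ℕ :=
  [0x20000000200000, 0x20000000800000, 0x80000000200000, 0x80000000800000, 0x1100000000200000,
   0x1400000000200000, 0x2000000000200000, 0x2000000000800000, 0x2000000020000000,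
   0x2000000080000000, 0x4001000000200000, 0x4004000000200000, 0x8000000000200000,
   0x8000000000410000, 0x8000000000440000, 0x8000000000800000, 0x8000000001100000,
   0x8000000004100000, 0x8000000020000000, 0x8000000080000000]

/-- The pairs of vertices of the copies `0` and `1` of `S^2` in `S^3` at distance at most `6`, and
those at distance at most `7`. -/
def conflicts01 : ℕ × ℕ :=
  (0xf01f0000901f0000b0bf0000901f0000101f0000101f0000b0bf0000101f0000f0ff0000f0ff0000faff0000f0ff0000101f0000101f0000b0bf0000101f,
   0xf8bf0000f0bf0000f0ff0000f0bf0000b0bf0000b0bf0000f0ff0000b0bf0000faff0000faff0000ffff0000faff0000b0bf0000b0bf0000f0ff0000b0bf)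

/-- The pairs of vertices of the copies `0` and `3` of `S^2` in `S^3` at distance at most `6`, and
those at distance at most `7`. -/
def conflicts03 : ℕ × ℕ :=
  (0xfaff0000f0ff0000f0ff0000f0ff0000b0bf0000101f0000101f0000101f0000b0bf0000103f000010ff0000103f0000b0bf0000101f0000101f0000101f,
   0xffff0000faff0000faff0000faff0000f0ff0000b0bf0000b0bf0000b0bf0000f0ff0000b0ff0000b2ff0000b0ff0000f0ff0000b0bf0000b0bf0000b0bf)

/-- The pairs of vertices of the copies `1` and `2` of `S^2` in `S^3` at distance at most `6`, and
those at distance at most `7`. -/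
def conflicts12 : ℕ × ℕ :=
  (0xf2f20000ffff0000a2f2000080f00000ffff0000ffff0000ffff0000ffff000022f20000ffff000022f2000000f000000020000000000000002000000000,
   0xffff0000ffff0000ffff0000f2f20000ffff0000ffff0000ffff0000ffff0000ffff0000ffff0000ffff000022f2000080f000000020000000f000000020)

/-- The pairs of vertices of the copies `1` and `3` of `S^2` in `S^3` at distance at most `6`, and
those at distance at most `7`. -/
def conflicts13 : ℕ × ℕ :=
  (0xffff0000ffff0000ffff0000ffff0000ffff00002ef2000026f2000022f20000ffff000022f2000022f2000022f20000ffff000022f2000022f3000022fb,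
   0xffff0000ffff0000ffff0000ffff0000ffff0000ffff0000ffff0000ffff0000ffff0000ffff0000ffff0000ffff0000ffff0000ffff0000ffff0000ffff)

/-- The pairs of vertices of the copies `2` and `3` of `S^2` in `S^3` at distance at most `6`, and
those at distance at most `7`. -/
def conflicts23 : ℕ × ℕ :=
  (0xfffa0000fff00000fff00000fff00000efe000004f4000004f4000004f400000efe000004f6000004ff000004f600000efe000004f4000004f4000004f40,
   0xffff0000fffa0000fffa0000fffa0000fff00000efe00000efe00000efe00000fff00000eff00000eff20000eff00000fff00000efe00000efe00000efe0)

/-! ### Verification of the search data -/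

theorem squareExceptions_refuted : (squareExceptions.all fun E =>
    refute (0xffff &&& (0xffff ^^^ E)) squareRows 0 0 0 0 0) = true := by decide +kernel

theorem square_refuted : refute 0xffff squareRows 0 0 0 0 0 = true := by decide +kernel

theorem cubeExceptions_refuted : (cubeExceptions.all fun E =>
    refute (0xffff0000ffff0000 &&& (0xffff0000ffff0000 ^^^ E)) cubeRows 0 0 0 0 0) = true := by decide +kernel

theorem follows_squareSteps : Follows squareSteps 2 := by decide +kernel

theorem follows_cubeSteps : Follows cubeSteps 3 := by decide +kernel

theorem rowsFollow_squareRows : RowsFollow squareSteps 2 0 squareRows := by decide +kernel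

/-- Inclusion of a copy of `S^2` in `S^3` does not increase distances, so one table of bans serves
all four copies. -/
theorem rowsFollow_copies : ((List.range 4).all fun i =>
    RowsFollow cubeSteps 3 (16 * i) squareRows) = true := by decide +kernel

theorem rowsFollow_cubeRows : RowsFollow cubeSteps 3 0 cubeRows := by decide +kernel

/-- All the vertices in a copy of `S^2` in `S^3` are at distance at most `6` from each other. -/
theorem copies_near : ((List.range 4).all fun i => (List.range 16).all fun a =>
    Nat.beq ((0xffff <<< (16 * i)) &&& reach cubeSteps 6 (1 <<< (16 * i + a)))
      (0xffff <<< (16 * i))) = true := by decide +kernel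

/-! ### Positions of the colors 6 and 7 in the copies of `S^2` -/

/-- The only vertex of color `6` (of color `7`) among those with codes `o, …, o + 15` is `s.1`
(is `s.2`), and there is none if this number is `16`. -/
def HasOption (f : ℕ → ℕ) (o : ℕ) (s : ℕ × ℕ) : Prop :=
  ∀ a < 16, (f (o + a) = 6 ↔ a = s.1) ∧ (f (o + a) = 7 ↔ a = s.2)

/-- The set `{p}`, or the empty set if `p = 16`. -/
def optionMask (p : ℕ) : ℕ := (1 <<< p) % 65536

theorem testBit_optionMask {p a : ℕ} : (optionMask p).testBit a = true ↔ a < 16 ∧ a = p := by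
  rw [optionMask, show 65536 = 2 ^ 16 from rfl, Nat.testBit_mod_two_pow, Nat.one_shiftLeft,
    Nat.testBit_two_pow, Bool.and_eq_true, decide_eq_true_eq, decide_eq_true_eq, eq_comm (a := p)]

theorem testBit_of_land_eq {E m w : ℕ} (h : Nat.beq (E &&& m) m) (hw : m.testBit w) :
    E.testBit w := by
  rw [← Nat.eq_of_beq_eq_true h, Nat.testBit_and, Bool.and_eq_true] at hw
  exact hw.1

theorem testBit_land_xor {A E w : ℕ} (hw : (A &&& (A ^^^ E)).testBit w) :
    A.testBit w = true ∧ ¬ E.testBit w := by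
  rw [Nat.testBit_and, Nat.testBit_xor] at hw
  revert hw
  cases A.testBit w <;> cases E.testBit w <;> simp

theorem testBit_square {w : ℕ} : (0xffff).testBit w = true ↔ w < 16 := by
  rw [show 0xffff = 2 ^ 16 - 1 from rfl, Nat.testBit_two_pow_sub_one, decide_eq_true_eq]

/-- A pair of positions outside `options` either gives two colors to one vertex or lies in an
exceptional set, whose complement is not colorable with `1, …, 5`. -/
theorem options_complete : ((List.range 17).all fun p => (List.range 17).all fun q =>
    (options.any fun s => Nat.beq s.1 p && Nat.beq s.2 q) || (Nat.beq p q && Nat.blt p 16) ||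
      squareExceptions.any fun E => Nat.beq (E &&& (optionMask p ||| optionMask q))
        (optionMask p ||| optionMask q)) = true := by decide +kernel

/-- A copy lies in the ball of radius 6 about each of its vertices, so a color `c ≥ 6` cannot occur
twice in it. -/
theorem exists_position {f : ℕ → ℕ} (hf : IsCodeColoring cubeSteps 3 7 f) {i : ℕ} (hi : i < 4)
    {c : ℕ} (hc : 6 ≤ c) : ∃ p < 17, ∀ a < 16, (f (16 * i + a) = c ↔ a = p) := by
  by_cases h : ∃ p < 16, f (16 * i + p) = c
  · obtain ⟨p, hp, hpc⟩ := h
    refine ⟨p, by omega, fun a ha => ⟨fun hac => ?_, fun hap => hap ▸ hpc⟩⟩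
    have h1 := List.all_eq_true.mp (List.all_eq_true.mp copies_near i (List.mem_range.mpr hi)) p
      (List.mem_range.mpr hp)
    have h2 : (0xffff <<< (16 * i)).testBit (16 * i + a) = true := by
      rw [Nat.testBit_shiftLeft, Nat.add_sub_cancel_left, testBit_square.mpr ha]
      simp
    rw [← Nat.eq_of_beq_eq_true h1, Nat.testBit_and, Bool.and_eq_true] at h2
    have h3 := hf.2 (16 * i + p) (by omega) (16 * i + a)
      (testBit_reach_of_le _ _ _ (hpc.symm ▸ hc) h2.2) (hac.trans hpc.symm)
    omega
  · exact ⟨16, by omega, fun a ha => ⟨fun hac => absurd ⟨a, ha, hac⟩ h, fun hap => by omega⟩⟩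

theorem exists_option {f : ℕ → ℕ} (hf : IsCodeColoring cubeSteps 3 7 f) {i : ℕ} (hi : i < 4) :
    ∃ s ∈ options, HasOption f (16 * i) s := by
  obtain ⟨p, hp, hp6⟩ := exists_position hf hi (c := 6) le_rfl
  obtain ⟨q, hq, hq7⟩ := exists_position hf hi (c := 7) (by omega)
  have h := List.all_eq_true.mp (List.all_eq_true.mp options_complete p (List.mem_range.mpr hp)) q
    (List.mem_range.mpr hq)
  rw [Bool.or_eq_true, Bool.or_eq_true] at h
  rcases h with (h | h) | h
  · obtain ⟨s, hs, h⟩ := List.any_eq_true.mp h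
    rw [Bool.and_eq_true] at h
    refine ⟨s, hs, fun a ha => ?_⟩
    rw [Nat.eq_of_beq_eq_true h.1, Nat.eq_of_beq_eq_true h.2]
    exact ⟨hp6 a ha, hq7 a ha⟩
  · rw [Bool.and_eq_true, Nat.blt_eq] at h
    obtain rfl := Nat.eq_of_beq_eq_true h.1
    have h6 := (hp6 p h.2).mpr rfl
    have h7 := (hq7 p h.2).mpr rfl
    omega
  · obtain ⟨E, hE, h⟩ := List.any_eq_true.mp h
    have h1 := List.all_eq_true.mp squareExceptions_refuted E hE
    rw [hf.refute_eq_false (List.all_eq_true.mp rowsFollow_copies i (List.mem_range.mpr hi))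
      fun w hw => ?_] at h1
    · exact absurd h1 Bool.false_ne_true
    · obtain ⟨hw16, hwE⟩ := testBit_land_xor hw
      rw [testBit_square] at hw16
      have hE' : w = p ∨ w = q → False := fun hpq => by
        refine hwE (testBit_of_land_eq h ?_)
        rw [Nat.testBit_or, Bool.or_eq_true, testBit_optionMask, testBit_optionMask]
        exact hpq.imp (⟨hw16, ·⟩) (⟨hw16, ·⟩)
      have hfw := hf.1 (16 * i + w) (by omega)
      have h6 := mt (hp6 w hw16).mp fun h => hE' (.inl h)
      have h7 := mt (hq7 w hw16).mp fun h => hE' (.inr h)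
      omega

/-- The options `s` and `t` put no two vertices of the same color in conflict. -/
def Compatible (C : ℕ × ℕ) (s t : ℕ × ℕ) : Bool :=
  isFree C.1 (32 * s.1 + t.1) && isFree C.2 (32 * s.2 + t.2)

/-- The bits of `C` stand for pairs of vertices with codes from `o` and `o'` on that are at distance
at most `r` in `S^3`. -/
def ConflictsFollow (C r o o' : ℕ) : Bool :=
  Nat.blt C (2 ^ 512) && (List.range 512).all fun t => isFree C t ||
    (Nat.blt (t % 32) 16 && (reach cubeSteps r (1 <<< (o + t / 32))).testBit (o' + t % 32))

set_option exponentiation.threshold 512 in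
theorem isFree_of_conflictsFollow {f : ℕ → ℕ} (hf : IsCodeColoring cubeSteps 3 7 f)
    {C r o o' p q : ℕ} (hC : ConflictsFollow C r o o') (ho : o + 16 ≤ o') (ho' : o' + 16 ≤ 64)
    (hp : ∀ a < 16, a = p → f (o + a) = r) (hq : ∀ a < 16, a = q → f (o' + a) = r) (hq17 : q < 17) :
    isFree C (32 * p + q) = true := by
  rw [ConflictsFollow, Bool.and_eq_true, Nat.blt_eq] at hC
  by_contra hbit
  rw [isFree_eq, Bool.not_eq_true'] at hbit
  -- An absent color is harmless: `p = 16` points beyond the 512 bits of `C`, and `q = 16` points to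
  -- a bit that `ConflictsFollow` forces to be zero. The row length 32 leaves room for it.
  have hlt : 32 * p + q < 512 := by
    by_contra hge
    refine hbit (Nat.testBit_lt_two_pow (hC.1.trans_le ?_))
    exact Nat.pow_le_pow_right (by norm_num) (not_lt.mp hge)
  have h := List.all_eq_true.mp hC.2 _ (List.mem_range.mpr hlt)
  rw [isFree_eq, Bool.eq_true_of_not_eq_false hbit, Bool.not_true, Bool.false_or, Bool.and_eq_true,
    Nat.blt_eq, show (32 * p + q) % 32 = q by omega, show (32 * p + q) / 32 = p by omega] at h
  have hp' := hp p (by omega) rfl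
  have hq' := hq q h.1 rfl
  have := hf.2 (o + p) (by omega) (o' + q) (by rw [hp']; exact h.2) (hq'.trans hp'.symm)
  omega

theorem options_lt : (options.all fun s => Nat.blt s.1 17 && Nat.blt s.2 17) = true := by
  decide +kernel

theorem compatible_of_hasOption {f : ℕ → ℕ} (hf : IsCodeColoring cubeSteps 3 7 f)
    {C : ℕ × ℕ} {o o' : ℕ} {s t : ℕ × ℕ}
    (hC : (ConflictsFollow C.1 6 o o' && ConflictsFollow C.2 7 o o') = true)
    (ho : o + 16 ≤ o') (ho' : o' + 16 ≤ 64) (ht : t ∈ options)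
    (hs : HasOption f o s) (ht' : HasOption f o' t) : Compatible C s t = true := by
  have hlt := List.all_eq_true.mp options_lt t ht
  rw [Bool.and_eq_true, Nat.blt_eq, Nat.blt_eq] at hlt
  rw [Bool.and_eq_true] at hC
  rw [Compatible, Bool.and_eq_true]
  exact ⟨isFree_of_conflictsFollow hf hC.1 ho ho' (fun a ha => (hs a ha).1.mpr)
      (fun a ha => (ht' a ha).1.mpr) hlt.1,
    isFree_of_conflictsFollow hf hC.2 ho ho' (fun a ha => (hs a ha).2.mpr)
      (fun a ha => (ht' a ha).2.mpr) hlt.2⟩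

/-- The vertices of colors `6` and `7` in the copies `1` and `3` of `S^2` in `S^3`. -/
def pairMask (s t : ℕ × ℕ) : ℕ :=
  ((optionMask s.1 ||| optionMask s.2) <<< 16) ||| ((optionMask t.1 ||| optionMask t.2) <<< 48)

/-- Once the options `s` and `t` of the copies 1 and 3 are fixed, the copies 0 and 2 can be tested
separately; conflicts between these two are not needed. An exceptional set may be larger than the
set of vertices colored 6 or 7, since refuting fewer vertices is stronger. -/
theorem pairs_complete : (options.all fun s => options.all fun t =>
    !Compatible conflicts13 s t ||
      (!(options.any fun u => Compatible conflicts01 u s && Compatible conflicts03 u t) ||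
        (!(options.any fun u => Compatible conflicts12 s u && Compatible conflicts23 u t) ||
          cubeExceptions.any fun E => Nat.beq (E &&& pairMask s t) (pairMask s t)))) = true := by
  decide +kernel

theorem conflicts01_follow :
    (ConflictsFollow conflicts01.1 6 0 16 && ConflictsFollow conflicts01.2 7 0 16) = true := by
  decide +kernel

theorem conflicts03_follow :
    (ConflictsFollow conflicts03.1 6 0 48 && ConflictsFollow conflicts03.2 7 0 48) = true := by
  decide +kernel

theorem conflicts12_follow :
    (ConflictsFollow conflicts12.1 6 16 32 && ConflictsFollow conflicts12.2 7 16 32) = true := by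
  decide +kernel

theorem conflicts13_follow :
    (ConflictsFollow conflicts13.1 6 16 48 && ConflictsFollow conflicts13.2 7 16 48) = true := by
  decide +kernel

theorem conflicts23_follow :
    (ConflictsFollow conflicts23.1 6 32 48 && ConflictsFollow conflicts23.2 7 32 48) = true := by
  decide +kernel

theorem not_isCodeColoring_cube (f : ℕ → ℕ) : ¬ IsCodeColoring cubeSteps 3 7 f := fun hf => by
  obtain ⟨s0, hs0, h0⟩ := exists_option hf (i := 0) (by omega)
  obtain ⟨s1, hs1, h1⟩ := exists_option hf (i := 1) (by omega)
  obtain ⟨s2, hs2, h2⟩ := exists_option hf (i := 2) (by omega)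
  obtain ⟨s3, hs3, h3⟩ := exists_option hf (i := 3) (by omega)
  have h := List.all_eq_true.mp (List.all_eq_true.mp pairs_complete s1 hs1) s3 hs3
  rw [compatible_of_hasOption hf conflicts13_follow (by omega) (by omega) hs3 h1 h3, Bool.not_true,
    Bool.false_or, List.any_eq_true.mpr ⟨s0, hs0, (Bool.and_eq_true _ _).mpr
      ⟨compatible_of_hasOption hf conflicts01_follow (by omega) (by omega) hs1 h0 h1,
      compatible_of_hasOption hf conflicts03_follow (by omega) (by omega) hs3 h0 h3⟩⟩, Bool.not_true,
    Bool.false_or, List.any_eq_true.mpr ⟨s2, hs2, (Bool.and_eq_true _ _).mpr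
      ⟨compatible_of_hasOption hf conflicts12_follow (by omega) (by omega) hs2 h1 h2,
      compatible_of_hasOption hf conflicts23_follow (by omega) (by omega) hs3 h2 h3⟩⟩, Bool.not_true,
    Bool.false_or] at h
  obtain ⟨E, hE, h⟩ := List.any_eq_true.mp h
  have h4 := List.all_eq_true.mp cubeExceptions_refuted E hE
  rw [hf.refute_eq_false rowsFollow_cubeRows fun w hw => ?_] at h4
  · exact absurd h4 Bool.false_ne_true
  · obtain ⟨hwR, hwE⟩ := testBit_land_xor hw
    rw [show 0xffff0000ffff0000 = (0xffff <<< 16) ||| (0xffff <<< 48) from rfl, Nat.testBit_or,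
      Bool.or_eq_true, Nat.testBit_shiftLeft, Nat.testBit_shiftLeft, Bool.and_eq_true,
      Bool.and_eq_true, testBit_square, testBit_square, decide_eq_true_eq, decide_eq_true_eq] at hwR
    have hE' := mt (testBit_of_land_eq h) hwE
    simp only [pairMask, Nat.testBit_or, Nat.testBit_shiftLeft, Bool.or_eq_true, Bool.and_eq_true,
      decide_eq_true_eq, testBit_optionMask] at hE'
    have hfw := hf.1 (0 + w) (by omega)
    rcases hwR with hwR | hwR
    · obtain ⟨h6, h7⟩ := h1 (w - 16) (by omega)
      rw [show 16 * 1 + (w - 16) = 0 + w by omega] at h6 h7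
      have h6' : f (0 + w) ≠ 6 := fun h => hE' (.inl ⟨hwR.1, .inl ⟨hwR.2, h6.mp h⟩⟩)
      have h7' : f (0 + w) ≠ 7 := fun h => hE' (.inl ⟨hwR.1, .inr ⟨hwR.2, h7.mp h⟩⟩)
      omega
    · obtain ⟨h6, h7⟩ := h3 (w - 48) (by omega)
      rw [show 16 * 3 + (w - 48) = 0 + w by omega] at h6 h7
      have h6' : f (0 + w) ≠ 6 := fun h => hE' (.inr ⟨hwR.1, .inl ⟨hwR.2, h6.mp h⟩⟩)
      have h7' : f (0 + w) ≠ 7 := fun h => hE' (.inr ⟨hwR.1, .inr ⟨hwR.2, h7.mp h⟩⟩)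
      omega

/-! ### Lower bounds for the graphs and the conclusion -/

theorem not_isCodeColoring_square (f : ℕ → ℕ) : ¬ IsCodeColoring squareSteps 2 5 f := fun hf => by
  have h := square_refuted
  rw [hf.refute_eq_false rowsFollow_squareRows fun w hw => ?_] at h
  · exact absurd h Bool.false_ne_true
  · rw [testBit_square] at hw
    exact hf.1 _ (by omega)

theorem sierpinski_not_isPackingColoring_three {c : (Fin 3 → Fin 4) → ℕ} :
    ¬ (K4MinusEdge.sierpinski 3).IsPackingColoring 7 c := fun hc =>
  let ⟨f, hf⟩ := exists_isCodeColoring follows_cubeSteps hc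
  not_isCodeColoring_cube f hf

theorem sierpinski_not_isPackingColoring_two {c : (Fin 2 → Fin 4) → ℕ} :
    ¬ (K4MinusEdge.sierpinski 2).IsPackingColoring 5 c := fun hc =>
  let ⟨f, hf⟩ := exists_isCodeColoring follows_squareSteps hc
  not_isCodeColoring_square f hf

theorem sierpinski_not_isPackingColoring_one {c : (Fin 1 → Fin 4) → ℕ} :
    ¬ (K4MinusEdge.sierpinski 1).IsPackingColoring 2 c := fun hc => by
  have h : ∀ x y : Fin 4, K4MinusEdge.Adj x y → c (fun _ => x) ≠ c fun _ => y := fun x y hxy h => by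
    have hadj : (K4MinusEdge.sierpinski 1).Adj (fun _ => x) fun _ => y :=
      ⟨0, fun j hj => absurd hj (Fin.not_lt_zero _), hxy, fun j hj => by omega⟩
    have hx := hc.1 fun _ => x
    have := hc.2 _ hx.1 hx.2 _ rfl _ h.symm hadj.ne
    rw [edist_eq_one_iff_adj.mpr hadj] at this
    have h1 : c (fun _ => x) < 1 := by exact_mod_cast this
    omega
  -- The letters 0, 1, 3 form a triangle, which needs three colors.
  have h01 := h 0 1 ((adj_iff_mem_arcs 0 1).mpr (by decide))
  have h13 := h 1 3 ((adj_iff_mem_arcs 1 3).mpr (by decide))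
  have h03 := h 0 3 ((adj_iff_mem_arcs 0 3).mpr (by decide))
  have := hc.1 fun _ => 0
  have := hc.1 fun _ => 1
  have := hc.1 fun _ => 3
  omega

theorem mainTheorem5 :
    (K4MinusEdge.sierpinski 1).packingChromaticNumber = 3 ∧
    (K4MinusEdge.sierpinski 2).packingChromaticNumber = 6 ∧
    (K4MinusEdge.sierpinski 3).packingChromaticNumber = 8 ∧
    ∀ n : ℕ, 4 ≤ n →
      8 ≤ (K4MinusEdge.sierpinski n).packingChromaticNumber ∧
      (K4MinusEdge.sierpinski n).packingChromaticNumber ≤ 11 := by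
  refine ⟨le_antisymm ?_ ?_, le_antisymm ?_ ?_, le_antisymm ?_ ?_, fun n hn => ⟨?_, ?_⟩⟩
  · exact packingChromaticNumber_le
      (isPackingColoring_of_classes covers_blockSteps_one isPackingClasses_one)
  · exact le_packingChromaticNumber fun _ => sierpinski_not_isPackingColoring_one
  · exact packingChromaticNumber_le
      (isPackingColoring_of_classes covers_blockSteps_two isPackingClasses_two)
  · exact le_packingChromaticNumber fun _ => sierpinski_not_isPackingColoring_two
  · exact packingChromaticNumber_le
      (isPackingColoring_of_classes covers_blockSteps_three isPackingClasses_three)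
  · exact le_packingChromaticNumber fun _ => sierpinski_not_isPackingColoring_three
  · obtain ⟨m, rfl⟩ := Nat.exists_eq_add_of_le' (show 3 ≤ n by omega)
    exact le_packingChromaticNumber fun _ hc => sierpinski_not_isPackingColoring_three
      (hc.comp (prependHom (fun _ => 0) 3) (prependHom_injective _ 3))
  · obtain ⟨m, rfl⟩ := Nat.exists_eq_add_of_le' hn
    exact packingChromaticNumber_le (isPackingColoring_block m)
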